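/- Let $n,k,l\ge 1$ be integers and let $A_{k,l}=(-\Delta)^l+|x|^{2k}+1$ be the anharmonic oscillator on $\mathbb{R}^n$. Let $(u_j)_{j\in\mathbb{N}}$ be an orthonormal basis of $L^2(\mathbb{R}^n)$ consisting of eigenfunctions of $A_{k,l}$, that is, $A_{k,l}u_j=\lambda_j u_j$ with $\lambda_j\in\mathbb{R}$ (in the sense of tempered distributions). Define the $A_{k,l}$-Fourier transform by $$(\mathcal{F}_{A_{k,l}}f)(j)=\int_{\mathbb{R}^n} f(x)\,\overline{u_j(x)}\,dx,\qquad j\in\mathbb{N}.$$ Let $1<p\le 2$ and let $\varphi:\mathbb{N}\to(0,\infty)$ be a sequence such that $$M_\varphi:=\sup_{t>0}\; t\sum_{j\in\mathbb{N}:\ \varphi(j)\ge t}\|u_j\|_{L^\infty(\mathbb{R}^n)}^2<\infty .$$ Then for every $f\in L^p(\mathbb{R}^n)$ the integrals defining $(\mathcal{F}_{A_{k,l}}f)(j)$ converge absolutely and $$\Big(\sum_{j\in\mathbb{N}}|(\mathcal{F}_{A_{k,l}}f)(j)|^p\,\|u_j\|_{L^\infty(\mathbb{R}^n)}^{2-p}\,\varphi(j)^{2-p}\Big)^{1/p}\le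 C_p\,M_\varphi^{\frac{2-p}{p}}\,\|f\|_{L^p(\mathbb{R}^n)},$$ where the constant $C_p$ depends only on $p$. -/

import Mathlib

open MeasureTheory Laplacian
open scoped ENNReal NNReal SchwartzMap ComplexConjugate

namespace Anharmonic

noncomputable section

/-- The potential `x ↦ |x|^{2k} + 1` on `ℝⁿ` (Euclidean norm), as a complex-valued function. -/
def potential (n k : ℕ) (x : EuclideanSpace ℝ (Fin n)) : ℂ :=
  ((‖x‖ ^ (2 * k) + 1 : ℝ) : ℂ)

/-- The potential has temperate growth, so multiplication by it is the genuine multiplication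
operator on tempered distributions (and not the default value of `smulLeftCLM`). -/
theorem potential_hasTemperateGrowth (n k : ℕ) : (potential n k).HasTemperateGrowth := by
  have h := ((Function.hasTemperateGrowth_norm_sq
    (H := EuclideanSpace ℝ (Fin n))).pow k).add (Function.HasTemperateGrowth.const (1 : ℝ))
  have h2 := Function.HasTemperateGrowth.comp Function.Complex.hasTemperateGrowth_ofReal h
  have e : potential n k = Complex.ofReal ∘
      ((fun x : EuclideanSpace ℝ (Fin n) => ‖x‖ ^ 2) ^ k + fun _ => (1 : ℝ)) := by
    funext x
    simp [potential, pow_mul]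
  rw [e]
  exact h2

/-- The anharmonic oscillator `A_{k,l} = (-Δ)^l + |x|^{2k} + 1` on `ℝⁿ`, acting on tempered
distributions. -/
def oscillator (n k l : ℕ) (T : 𝓢'(EuclideanSpace ℝ (Fin n), ℂ)) :
    𝓢'(EuclideanSpace ℝ (Fin n), ℂ) :=
  (fun S : 𝓢'(EuclideanSpace ℝ (Fin n), ℂ) => -Δ S)^[l] T +
    TemperedDistribution.smulLeftCLM ℂ (potential n k) T

/-- The orthonormal basis `(u_j)` of `L²(ℝⁿ)` consists of eigenfunctions of `A_{k,l}`:
`A_{k,l} u_j = λ_j u_j` for real numbers `λ_j`. Since `A_{k,l} u_j` is then in `L²`, each `u_j` lies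
in the `L²`-domain of `A_{k,l}`. -/
def IsEigenbasis (n k l : ℕ) (lam : ℕ → ℝ)
    (u : HilbertBasis ℕ ℂ (Lp ℂ 2 (volume : Measure (EuclideanSpace ℝ (Fin n))))) : Prop :=
  ∀ j, oscillator n k l (Lp.toTemperedDistribution (u j)) =
    (lam j : ℂ) • Lp.toTemperedDistribution (u j)

/-- The `A_{k,l}`-Fourier transform `(F f)(j) = ∫ f(x) conj(u_j(x)) dx`. -/
def fourier {n : ℕ}
    (u : HilbertBasis ℕ ℂ (Lp ℂ 2 (volume : Measure (EuclideanSpace ℝ (Fin n)))))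
    (f : EuclideanSpace ℝ (Fin n) → ℂ) (j : ℕ) : ℂ :=
  ∫ x, f x * conj (u j x)

/-- The (possibly infinite) norm `‖u_j‖_{L^∞(ℝⁿ)}`. -/
def supNorm {n : ℕ}
    (u : HilbertBasis ℕ ℂ (Lp ℂ 2 (volume : Measure (EuclideanSpace ℝ (Fin n))))) (j : ℕ) : ℝ≥0∞ :=
  eLpNorm (u j) ∞ volume

/-- `M_φ = sup_{t > 0} t ∑_{j : φ(j) ≥ t} ‖u_j‖_∞²`, in `[0, ∞]`. -/
def paleyConst {n : ℕ}
    (u : HilbertBasis ℕ ℂ (Lp ℂ 2 (volume : Measure (EuclideanSpace ℝ (Fin n)))))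
    (φ : ℕ → ℝ) : ℝ≥0∞ :=
  ⨆ (t : ℝ) (_ : 0 < t), ENNReal.ofReal t * ∑' j : {j : ℕ // t ≤ φ j}, supNorm u j ^ 2

end

end Anharmonic

/-!
Divide the coefficients `∫ f conj(u_j)` by `w_j = ‖u_j‖_∞ φ(j)` and give the index `j` the mass
`w_j²`. The resulting sublinear operator is of type `(2, 2)` by Bessel's inequality, which is the
case `p = 2`. It is of weak type `(1, 1)` with constant `2 M_φ`: since
`|∫ f conj(u_j)| ≤ ‖u_j‖_∞ ‖f‖₁`, its values exceed `t` only where `φ < ‖f‖₁ / t`, and there the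
total mass `∑ ‖u_j‖_∞² φ(j)²` is at most `2 M_φ ‖f‖₁ / t`, by summation over the level sets of `φ`.
Marcinkiewicz interpolation gives the inequality for `1 < p < 2`.
-/

namespace Paley

section PowerIntegrals

theorem setLIntegral_Ioo_zero_rpow {q s : ℝ} (hq : -1 < q) (hs : 0 ≤ s) :
    ∫⁻ t in Set.Ioo 0 s, ENNReal.ofReal (t ^ q) = ENNReal.ofReal (s ^ (q + 1) / (q + 1)) := by
  have hint : IntegrableOn (fun t : ℝ => t ^ q) (Set.Ioc 0 s) := by
    rw [← intervalIntegrable_iff_integrableOn_Ioc_of_le hs]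
    exact intervalIntegral.intervalIntegrable_rpow' hq
  rw [setLIntegral_congr Ioo_ae_eq_Ioc, ← ofReal_integral_eq_lintegral_ofReal hint,
    ← intervalIntegral.integral_of_le hs, integral_rpow (Or.inl hq),
    Real.zero_rpow (by linarith), sub_zero]
  filter_upwards [ae_restrict_mem measurableSet_Ioc] with t ht
  exact Real.rpow_nonneg ht.1.le _

theorem setLIntegral_Ici_rpow {q s : ℝ} (hq : q < -1) (hs : 0 < s) :
    ∫⁻ t in Set.Ici s, ENNReal.ofReal (t ^ q) = ENNReal.ofReal (-s ^ (q + 1) / (q + 1)) := by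
  rw [setLIntegral_congr Ioi_ae_eq_Ici.symm,
    ← ofReal_integral_eq_lintegral_ofReal (integrableOn_Ioi_rpow_of_lt hq hs),
    integral_Ioi_rpow_of_lt hq hs]
  filter_upwards [ae_restrict_mem measurableSet_Ioi] with t ht
  exact Real.rpow_nonneg (hs.trans ht).le _

theorem lintegral_mul_setLIntegral_swap {α β : Type*} [MeasurableSpace α] [MeasurableSpace β]
    {μ : Measure α} {ν : Measure β} [SFinite μ] [SFinite ν] {S : Set (α × β)}
    (hS : MeasurableSet S) {k : α → ℝ≥0∞} (hk : Measurable k) {G : β → ℝ≥0∞} (hG : Measurable G) :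
    ∫⁻ a, k a * ∫⁻ b in {b | (a, b) ∈ S}, G b ∂ν ∂μ =
      ∫⁻ b, G b * ∫⁻ a in {a | (a, b) ∈ S}, k a ∂μ ∂ν := by
  have hmeas : Measurable (S.indicator fun z : α × β => k z.1 * G z.2) :=
    ((hk.comp measurable_fst).mul (hG.comp measurable_snd)).indicator hS
  calc ∫⁻ a, k a * ∫⁻ b in {b | (a, b) ∈ S}, G b ∂ν ∂μ
      = ∫⁻ a, ∫⁻ b, S.indicator (fun z => k z.1 * G z.2) (a, b) ∂ν ∂μ := by
        refine lintegral_congr fun a => ?_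
        have hSa : MeasurableSet {b | (a, b) ∈ S} := measurable_prodMk_left hS
        rw [← lintegral_const_mul _ hG, ← lintegral_indicator hSa]
        rfl
    _ = ∫⁻ b, ∫⁻ a, S.indicator (fun z => k z.1 * G z.2) (a, b) ∂μ ∂ν :=
        lintegral_lintegral_swap hmeas.aemeasurable
    _ = ∫⁻ b, G b * ∫⁻ a in {a | (a, b) ∈ S}, k a ∂μ ∂ν := by
        refine lintegral_congr fun b => ?_
        have hSb : MeasurableSet {a | (a, b) ∈ S} := measurable_prodMk_right hS
        rw [← lintegral_const_mul _ hk, ← lintegral_indicator hSb]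
        simp only [mul_comm (G b)]
        rfl

end PowerIntegrals

section Truncation

variable {X E : Type*} [MeasurableSpace X] {μ : Measure X} [NormedAddCommGroup E] {f : X → E}

theorem memLp_of_le_of_memLp_top {p q : ℝ≥0∞} (hp : p ≠ 0) (hpq : p ≤ q) (hf : MemLp f p μ)
    (hf_top : MemLp f ∞ μ) : MemLp f q μ := by
  rcases eq_or_ne q ∞ with rfl | hq
  · exact hf_top
  have hp' : p ≠ ∞ := ne_top_of_le_ne_top hq hpq
  have hq0 : q ≠ 0 := (hp.bot_lt.trans_le hpq).ne'
  have hpq' : 0 ≤ q.toReal - p.toReal := sub_nonneg.2 (ENNReal.toReal_mono hq hpq)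
  refine ⟨hf.1, (eLpNorm_lt_top_iff_lintegral_rpow_enorm_lt_top hq0 hq).2 ?_⟩
  calc ∫⁻ x, ‖f x‖ₑ ^ q.toReal ∂μ
      ≤ ∫⁻ x, eLpNormEssSup f μ ^ (q.toReal - p.toReal) * ‖f x‖ₑ ^ p.toReal ∂μ := by
        refine lintegral_mono_ae ?_
        filter_upwards [ae_le_eLpNormEssSup (f := f) (μ := μ)] with x hx
        calc ‖f x‖ₑ ^ q.toReal = ‖f x‖ₑ ^ (q.toReal - p.toReal) * ‖f x‖ₑ ^ p.toReal := by
              rw [← ENNReal.rpow_add_of_nonneg _ _ hpq' ENNReal.toReal_nonneg, sub_add_cancel]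
          _ ≤ _ := by gcongr
    _ = eLpNormEssSup f μ ^ (q.toReal - p.toReal) * ∫⁻ x, ‖f x‖ₑ ^ p.toReal ∂μ :=
        lintegral_const_mul' _ _ (ENNReal.rpow_ne_top_of_nonneg hpq' (by simpa using hf_top.2.ne))
    _ < ∞ := ENNReal.mul_lt_top (ENNReal.rpow_lt_top_of_nonneg hpq' (by simpa using hf_top.2.ne))
        ((eLpNorm_lt_top_iff_lintegral_rpow_enorm_lt_top hp hp').1 hf.2)

theorem integrable_indicator_lt_mul_norm {p : ℝ≥0∞} (hp1 : 1 ≤ p) (hp : p ≠ ∞)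
    (hf : StronglyMeasurable f) (hfp : MemLp f p μ) {c t : ℝ} (hc : 0 < c) (ht : 0 < t) :
    Integrable ({x | t < c * ‖f x‖}.indicator f) μ := by
  have hS : MeasurableSet {x | t < c * ‖f x‖} :=
    measurableSet_lt measurable_const (hf.norm.measurable.const_mul c)
  have hfin : μ {x | t < c * ‖f x‖} ≠ ∞ := by
    refine ((measure_mono fun x (hx : t < c * ‖f x‖) => ?_).trans_lt
      (hfp.meas_ge_lt_top (zero_lt_one.trans_le hp1).ne' hp
        (Real.toNNReal_pos.2 (div_pos ht hc)).ne')).ne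
    exact Real.toNNReal_le_iff_le_coe.2 ((div_le_iff₀' hc).2 hx.le)
  exact memLp_one_iff_integrable.1 <| (hfp.indicator hS).mono_exponent_of_measure_support_ne_top
    (fun x hx => Set.indicator_of_notMem hx f) hfin hp1

theorem memLp_indicator_compl_lt_mul_norm {p q : ℝ≥0∞} (hp : p ≠ 0) (hpq : p ≤ q)
    (hf : StronglyMeasurable f) (hfp : MemLp f p μ) {c t : ℝ} (hc : 0 < c) (ht : 0 ≤ t) :
    MemLp ({x | t < c * ‖f x‖}ᶜ.indicator f) q μ := by
  have hS : MeasurableSet {x | t < c * ‖f x‖} :=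
    measurableSet_lt measurable_const (hf.norm.measurable.const_mul c)
  refine memLp_of_le_of_memLp_top hp hpq (hfp.indicator hS.compl)
    (memLp_top_of_bound (hf.indicator hS.compl).aestronglyMeasurable (t / c)
      (.of_forall fun x => ?_))
  by_cases hx : t < c * ‖f x‖
  · rw [Set.indicator_of_notMem (not_not.2 hx), norm_zero]
    positivity
  · rw [Set.indicator_of_mem hx, le_div_iff₀' hc]
    exact not_lt.1 hx

theorem lintegral_rpow_mul_setLIntegral_lt_mul_norm [SFinite μ] {p c : ℝ} (hp : 1 < p) (hc : 0 < c)
    (hf : StronglyMeasurable f) :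
    ∫⁻ t in Set.Ioi (0 : ℝ), ENNReal.ofReal (t ^ (p - 2)) * ∫⁻ x in {x | t < c * ‖f x‖}, ‖f x‖ₑ ∂μ =
      ENNReal.ofReal (c ^ (p - 1) / (p - 1)) * ∫⁻ x, ‖f x‖ₑ ^ p ∂μ := by
  have hS : MeasurableSet {z : ℝ × X | z.1 < c * ‖f z.2‖} :=
    measurableSet_lt measurable_fst ((hf.norm.measurable.comp measurable_snd).const_mul c)
  have hinner (x : X) : ‖f x‖ₑ * ∫⁻ t in {t | t < c * ‖f x‖}, ENNReal.ofReal (t ^ (p - 2))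
      ∂volume.restrict (Set.Ioi 0) = ENNReal.ofReal (c ^ (p - 1) / (p - 1)) * ‖f x‖ₑ ^ p := by
    have hpow : ‖f x‖ * (c * ‖f x‖) ^ (p - 1) = c ^ (p - 1) * ‖f x‖ ^ p := by
      rw [Real.mul_rpow hc.le (norm_nonneg _), mul_left_comm, mul_comm ‖f x‖,
        ← Real.rpow_add_one' (norm_nonneg _) (by linarith), sub_add_cancel]
    have : 0 < p - 1 := by linarith
    rw [Set.Iio_def, Measure.restrict_restrict measurableSet_Iio, Set.Iio_inter_Ioi,
      setLIntegral_Ioo_zero_rpow (by linarith) (by positivity), ← ofReal_norm,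
      ENNReal.ofReal_rpow_of_nonneg (norm_nonneg _) (by linarith),
      ← ENNReal.ofReal_mul (by positivity), ← ENNReal.ofReal_mul (by positivity),
      show p - 2 + 1 = p - 1 by ring, ← mul_div_assoc, hpow, mul_div_right_comm]
  have hswap := lintegral_mul_setLIntegral_swap (μ := volume.restrict (Set.Ioi 0)) (ν := μ) hS
    (k := fun t => ENNReal.ofReal (t ^ (p - 2))) (by fun_prop) hf.enorm
  rw [← lintegral_const_mul _ (hf.enorm.pow_const p)]
  exact hswap.trans (lintegral_congr hinner)

theorem lintegral_rpow_mul_setLIntegral_compl_lt_mul_norm [SFinite μ] {p c : ℝ} (hp0 : 0 < p)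
    (hp : p < 2) (hc : 0 < c) (hf : StronglyMeasurable f) :
    ∫⁻ t in Set.Ioi (0 : ℝ), ENNReal.ofReal (t ^ (p - 3)) *
        ∫⁻ x in {x | t < c * ‖f x‖}ᶜ, ‖f x‖ₑ ^ 2 ∂μ =
      ENNReal.ofReal (c ^ (p - 2) / (2 - p)) * ∫⁻ x, ‖f x‖ₑ ^ p ∂μ := by
  have hS : MeasurableSet {z : ℝ × X | z.1 < c * ‖f z.2‖} :=
    measurableSet_lt measurable_fst ((hf.norm.measurable.comp measurable_snd).const_mul c)
  have hinner (x : X) : ‖f x‖ₑ ^ 2 * ∫⁻ t in {t | t < c * ‖f x‖}ᶜ, ENNReal.ofReal (t ^ (p - 3))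
      ∂volume.restrict (Set.Ioi 0) = ENNReal.ofReal (c ^ (p - 2) / (2 - p)) * ‖f x‖ₑ ^ p := by
    rcases (norm_nonneg (f x)).eq_or_lt with h0 | h0
    · simp [← ofReal_norm, ← h0, hp0]
    have hcf : 0 < c * ‖f x‖ := by positivity
    have hpow : ‖f x‖ ^ 2 * (c * ‖f x‖) ^ (p - 2) = c ^ (p - 2) * ‖f x‖ ^ p := by
      rw [Real.mul_rpow hc.le h0.le, mul_left_comm, ← Real.rpow_two, ← Real.rpow_add h0,
        add_sub_cancel]
    have : 0 < 2 - p := by linarith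
    rw [Set.Iio_def, Measure.restrict_restrict measurableSet_Iio.compl, Set.compl_Iio,
      Set.inter_eq_left.2 (Set.Ici_subset_Ioi.2 hcf), setLIntegral_Ici_rpow (by linarith) hcf,
      ← ofReal_norm, ENNReal.ofReal_rpow_of_nonneg (norm_nonneg _) hp0.le,
      ← ENNReal.ofReal_pow (norm_nonneg _), ← ENNReal.ofReal_mul (by positivity),
      ← ENNReal.ofReal_mul (by positivity), show p - 3 + 1 = -(2 - p) by ring, neg_div_neg_eq,
      neg_sub, ← mul_div_assoc, hpow, mul_div_right_comm]
  have hswap := lintegral_mul_setLIntegral_swap (μ := volume.restrict (Set.Ioi 0)) (ν := μ) hS.compl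
    (k := fun t => ENNReal.ofReal (t ^ (p - 3))) (by fun_prop) (hf.enorm.pow_const 2)
  rw [← lintegral_const_mul _ (hf.enorm.pow_const p)]
  exact hswap.trans (lintegral_congr hinner)

end Truncation

section Marcinkiewicz

variable {X Y E : Type*} [MeasurableSpace X] [MeasurableSpace Y] [NormedAddCommGroup E]
  {T : (X → E) → Y → ℝ≥0} {A B : ℝ≥0} {μ : Measure X} {ν : Measure Y} {f : X → E}

/-- The operator `T`, of which only the absolute value `|T g|` of the output is recorded, is of
weak type `(q, q)` with constant `A`. -/
def HasWeakType (T : (X → E) → Y → ℝ≥0) (q A : ℝ≥0) (μ : Measure X) (ν : Measure Y) : Prop :=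
  ∀ g, MemLp g q μ → ∀ t : ℝ≥0,
    (t : ℝ≥0∞) ^ (q : ℝ) * ν {y | t < T g y} ≤ (A * eLpNorm g q μ) ^ (q : ℝ)

theorem HasWeakType.measure_lt_indicator_le {q : ℝ≥0} (hT : HasWeakType T q A μ ν) (hq : q ≠ 0)
    {S : Set X} (hS : MeasurableSet S) (hf : MemLp (S.indicator f) q μ) {t : ℝ≥0} (ht : t ≠ 0) :
    ν {y | t < T (S.indicator f) y} ≤
      ENNReal.ofReal (A / t) ^ (q : ℝ) * ∫⁻ x in S, ‖f x‖ₑ ^ (q : ℝ) ∂μ := by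
  have ht0 : (t : ℝ≥0∞) ^ (q : ℝ) ≠ 0 := by simp [ht]
  have ht_top : (t : ℝ≥0∞) ^ (q : ℝ) ≠ ∞ := ENNReal.rpow_ne_top_of_nonneg q.coe_nonneg (by simp)
  have h := hT _ hf t
  rw [eLpNorm_indicator_eq_eLpNorm_restrict hS, ENNReal.mul_rpow_of_nonneg _ _ q.coe_nonneg,
    eLpNorm_nnreal_pow_eq_lintegral hq] at h
  rw [← NNReal.coe_div, ENNReal.ofReal_coe_nnreal, ENNReal.coe_div ht,
    ENNReal.div_rpow_of_nonneg _ _ q.coe_nonneg, ENNReal.mul_comm_div, ← mul_div_assoc,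
    ENNReal.le_div_iff_mul_le (.inl ht0) (.inl ht_top), mul_comm]
  exact h

theorem measure_lt_le_of_hasWeakType {p : ℝ≥0∞} (hp1 : 1 ≤ p) (hp2 : p ≤ 2)
    (hsub : ∀ g h, MemLp g 1 μ → MemLp h 2 μ → ∀ y, T (g + h) y ≤ T g y + T h y)
    (hT1 : HasWeakType T 1 A μ ν) (hT2 : HasWeakType T 2 B μ ν) (hf : StronglyMeasurable f)
    (hfp : MemLp f p μ) {c t : ℝ} (hc : 0 < c) (ht : 0 < t) :
    ν {y | t < T f y} ≤
      ENNReal.ofReal (2 * A / t) * ∫⁻ x in {x | t < c * ‖f x‖}, ‖f x‖ₑ ∂μ +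
        ENNReal.ofReal (2 * B / t) ^ 2 * ∫⁻ x in {x | t < c * ‖f x‖}ᶜ, ‖f x‖ₑ ^ 2 ∂μ := by
  have hS : MeasurableSet {x | t < c * ‖f x‖} :=
    measurableSet_lt measurable_const (hf.norm.measurable.const_mul c)
  set S := {x | t < c * ‖f x‖}
  have hg : MemLp (S.indicator f) 1 μ := memLp_one_iff_integrable.2 <|
    integrable_indicator_lt_mul_norm hp1 (ne_top_of_le_ne_top ENNReal.ofNat_ne_top hp2) hf hfp hc ht
  have hh : MemLp (Sᶜ.indicator f) 2 μ :=
    memLp_indicator_compl_lt_mul_norm (zero_lt_one.trans_le hp1).ne' hp2 hf hfp hc ht.le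
  obtain ⟨s, rfl⟩ : ∃ s : ℝ≥0, t = 2 * s :=
    ⟨(t / 2).toNNReal, by rw [Real.coe_toNNReal _ (by positivity), mul_div_cancel₀ t two_ne_zero]⟩
  have hs : s ≠ 0 := by rintro rfl; simp at ht
  have hsplit : {y | 2 * (s : ℝ) < T f y} ⊆
      {y | s < T (S.indicator f) y} ∪ {y | s < T (Sᶜ.indicator f) y} := by
    intro y (hy : 2 * (s : ℝ) < T f y)
    have hle := hsub _ _ hg hh y
    rw [Set.indicator_self_add_compl, ← NNReal.coe_le_coe, NNReal.coe_add] at hle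
    by_contra! hnot
    obtain ⟨h1, h2⟩ : T (S.indicator f) y ≤ s ∧ T (Sᶜ.indicator f) y ≤ s := by
      simpa [not_or] using hnot
    rw [← NNReal.coe_le_coe] at h1 h2
    linarith
  have hA := hT1.measure_lt_indicator_le one_ne_zero hS (by simpa using hg) hs
  have hB := hT2.measure_lt_indicator_le two_ne_zero hS.compl (by simpa using hh) hs
  simp only [NNReal.coe_one, ENNReal.rpow_one] at hA
  simp only [NNReal.coe_ofNat, ENNReal.rpow_two] at hB
  rw [mul_div_mul_left _ _ two_ne_zero, mul_div_mul_left _ _ two_ne_zero]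
  exact (measure_mono hsplit).trans ((measure_union_le _ _).trans (add_le_add hA hB))

theorem measure_lt_mul_rpow_le_of_hasWeakType {p : ℝ≥0∞} (hp1 : 1 ≤ p) (hp2 : p ≤ 2)
    (hsub : ∀ g h, MemLp g 1 μ → MemLp h 2 μ → ∀ y, T (g + h) y ≤ T g y + T h y)
    (hT1 : HasWeakType T 1 A μ ν) (hT2 : HasWeakType T 2 B μ ν) (hf : StronglyMeasurable f)
    (hfp : MemLp f p μ) {c t : ℝ} (hc : 0 < c) (ht : 0 < t) (q : ℝ) :
    ν {y | t < T f y} * ENNReal.ofReal (t ^ q) ≤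
      ENNReal.ofReal (2 * A) *
          (ENNReal.ofReal (t ^ (q - 1)) * ∫⁻ x in {x | t < c * ‖f x‖}, ‖f x‖ₑ ∂μ) +
        ENNReal.ofReal (4 * B ^ 2) *
          (ENNReal.ofReal (t ^ (q - 2)) * ∫⁻ x in {x | t < c * ‖f x‖}ᶜ, ‖f x‖ₑ ^ 2 ∂μ) := by
  have h1 : 2 * A / t * t ^ q = 2 * A * t ^ (q - 1) := by
    rw [Real.rpow_sub_one ht.ne']
    ring
  have h2 : (2 * B / t) ^ 2 * t ^ q = 4 * B ^ 2 * t ^ (q - 2) := by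
    rw [Real.rpow_sub ht, Real.rpow_two]
    ring
  grw [measure_lt_le_of_hasWeakType hp1 hp2 hsub hT1 hT2 hf hfp hc ht, add_mul, mul_right_comm,
    mul_right_comm (ENNReal.ofReal _ ^ 2), ← ENNReal.ofReal_pow (by positivity),
    ← ENNReal.ofReal_mul (by positivity), ← ENNReal.ofReal_mul (by positivity), h1, h2,
    ENNReal.ofReal_mul (by positivity), ENNReal.ofReal_mul (q := t ^ (q - 2)) (by positivity),
    mul_assoc, mul_assoc (ENNReal.ofReal (4 * B ^ 2))]

theorem lintegral_coe_rpow_eq_lintegral_meas_lt_mul {p : ℝ} (hp : 0 < p) {g : Y → ℝ≥0}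
    (hg : AEMeasurable g ν) :
    ∫⁻ y, (g y : ℝ≥0∞) ^ p ∂ν = ENNReal.ofReal p *
      ∫⁻ t in Set.Ioi (0 : ℝ), ν {y | t < g y} * ENNReal.ofReal (t ^ (p - 1)) := by
  rw [← lintegral_rpow_eq_lintegral_meas_lt_mul ν (.of_forall fun y => (g y).coe_nonneg)
    hg.coe_nnreal_real hp]
  refine lintegral_congr fun y => ?_
  rw [← ENNReal.ofReal_rpow_of_nonneg (g y).coe_nonneg hp.le, ENNReal.ofReal_coe_nnreal]

theorem lintegral_rpow_le_of_hasWeakType_of_height [SFinite μ] {p c : ℝ} (hp1 : 1 < p)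
    (hp2 : p < 2) (hc : 0 < c)
    (hsub : ∀ g h, MemLp g 1 μ → MemLp h 2 μ → ∀ y, T (g + h) y ≤ T g y + T h y)
    (hT1 : HasWeakType T 1 A μ ν) (hT2 : HasWeakType T 2 B μ ν)
    (hf : StronglyMeasurable f) (hfp : MemLp f (ENNReal.ofReal p) μ) (hTf : AEMeasurable (T f) ν) :
    ∫⁻ y, (T f y : ℝ≥0∞) ^ p ∂ν ≤
      ENNReal.ofReal (p * (2 * A * (c ^ (p - 1) / (p - 1)) + 4 * B ^ 2 * (c ^ (p - 2) / (2 - p)))) *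
        ∫⁻ x, ‖f x‖ₑ ^ p ∂μ := by
  have hmeas : Measurable fun t => ∫⁻ x in {x | t < c * ‖f x‖}, ‖f x‖ₑ ∂μ :=
    Antitone.measurable fun s t hst => lintegral_mono_set fun x hx => hst.trans_lt hx
  calc ∫⁻ y, (T f y : ℝ≥0∞) ^ p ∂ν
      = ENNReal.ofReal p *
          ∫⁻ t in Set.Ioi (0 : ℝ), ν {y | t < T f y} * ENNReal.ofReal (t ^ (p - 1)) :=
        lintegral_coe_rpow_eq_lintegral_meas_lt_mul (by linarith) hTf
    _ ≤ ENNReal.ofReal p * ∫⁻ t in Set.Ioi (0 : ℝ), (ENNReal.ofReal (2 * A) *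
            (ENNReal.ofReal (t ^ (p - 2)) * ∫⁻ x in {x | t < c * ‖f x‖}, ‖f x‖ₑ ∂μ) +
          ENNReal.ofReal (4 * B ^ 2) *
            (ENNReal.ofReal (t ^ (p - 3)) * ∫⁻ x in {x | t < c * ‖f x‖}ᶜ, ‖f x‖ₑ ^ 2 ∂μ)) := by
        gcongr ENNReal.ofReal p * ?_
        refine setLIntegral_mono' measurableSet_Ioi fun t ht => ?_
        convert measure_lt_mul_rpow_le_of_hasWeakType (by simpa using hp1.le)
          (by simpa using hp2.le) hsub hT1 hT2 hf hfp hc ht (p - 1) using 6 <;> ring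
    _ = ENNReal.ofReal p * (ENNReal.ofReal (2 * A) *
            (ENNReal.ofReal (c ^ (p - 1) / (p - 1)) * ∫⁻ x, ‖f x‖ₑ ^ p ∂μ) +
          ENNReal.ofReal (4 * B ^ 2) *
            (ENNReal.ofReal (c ^ (p - 2) / (2 - p)) * ∫⁻ x, ‖f x‖ₑ ^ p ∂μ)) := by
        rw [lintegral_add_left (by fun_prop), lintegral_const_mul _ (by fun_prop),
          lintegral_const_mul' _ _ ENNReal.ofReal_ne_top,
          lintegral_rpow_mul_setLIntegral_lt_mul_norm hp1 hc hf,
          lintegral_rpow_mul_setLIntegral_compl_lt_mul_norm (by linarith) hp2 hc hf]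
    _ = _ := by
        have : 0 < p - 1 := by linarith
        have : 0 < 2 - p := by linarith
        rw [ENNReal.ofReal_mul (p := p) (by linarith),
          ENNReal.ofReal_add (by positivity) (by positivity),
          ENNReal.ofReal_mul (p := 2 * (A : ℝ)) (by positivity),
          ENNReal.ofReal_mul (p := 4 * (B : ℝ) ^ 2) (by positivity), ← mul_assoc, ← mul_assoc,
          ← add_mul, mul_assoc]

/-- The constant in the Marcinkiewicz interpolation theorem between `L¹` and `L²`, for the
`p`-th powers of the norms. -/
noncomputable def marcinkiewiczConst (p : ℝ) : ℝ≥0 :=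
  (p * (2 / (p - 1) + 4 / (2 - p))).toNNReal

theorem marcinkiewiczConst_mul_rpow {p a b : ℝ} (hp1 : 1 < p) (hp2 : p < 2) (ha : 0 < a)
    (hb : 0 < b) :
    p * (2 * a * ((b ^ 2 / a) ^ (p - 1) / (p - 1)) +
        4 * b ^ 2 * ((b ^ 2 / a) ^ (p - 2) / (2 - p))) =
      marcinkiewiczConst p * a ^ (2 - p) * b ^ (2 * p - 2) := by
  have : 0 < p - 1 := by linarith
  have : 0 < 2 - p := by linarith
  have h1 : a * (b ^ 2 / a) ^ (p - 1) = a ^ (2 - p) * b ^ (2 * p - 2) := by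
    rw [Real.div_rpow (by positivity) ha.le, ← Real.rpow_natCast_mul hb.le, ← mul_div_assoc,
      mul_div_right_comm, show 2 - p = 1 - (p - 1) by ring, Real.rpow_one_sub' ha.le (by linarith)]
    push_cast
    ring_nf
  have h2 : b ^ 2 * (b ^ 2 / a) ^ (p - 2) = a ^ (2 - p) * b ^ (2 * p - 2) := by
    rw [← h1, show p - 2 = p - 1 - 1 by ring, Real.rpow_sub_one (by positivity)]
    field_simp
  rw [marcinkiewiczConst, Real.coe_toNNReal _ (by positivity)]
  linear_combination (2 * p / (p - 1)) * h1 + (4 * p / (2 - p)) * h2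

theorem lintegral_rpow_le_of_hasWeakType [SFinite μ] {p : ℝ} (hp1 : 1 < p) (hp2 : p < 2)
    (hsub : ∀ g h, MemLp g 1 μ → MemLp h 2 μ → ∀ y, T (g + h) y ≤ T g y + T h y)
    (hA : A ≠ 0) (hB : B ≠ 0) (hT1 : HasWeakType T 1 A μ ν) (hT2 : HasWeakType T 2 B μ ν)
    (hf : StronglyMeasurable f) (hfp : MemLp f (ENNReal.ofReal p) μ) (hTf : AEMeasurable (T f) ν) :
    ∫⁻ y, (T f y : ℝ≥0∞) ^ p ∂ν ≤
      (marcinkiewiczConst p * A ^ (2 - p) * B ^ (2 * p - 2) : ℝ≥0) * ∫⁻ x, ‖f x‖ₑ ^ p ∂μ := by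
  have hA0 : (0 : ℝ) < A := NNReal.coe_pos.2 hA.bot_lt
  have hB0 : (0 : ℝ) < B := NNReal.coe_pos.2 hB.bot_lt
  -- With this height the `L¹` part and the `L²` part contribute the same power of `A` and `B`.
  grw [lintegral_rpow_le_of_hasWeakType_of_height hp1 hp2 (c := B ^ 2 / A) (by positivity)
    hsub hT1 hT2 hf hfp hTf]
  rw [marcinkiewiczConst_mul_rpow hp1 hp2 hA0 hB0, ← NNReal.coe_rpow, ← NNReal.coe_rpow,
    ← NNReal.coe_mul, ← NNReal.coe_mul, ENNReal.ofReal_coe_nnreal]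

end Marcinkiewicz

section Tail

variable {Y : Type*} [MeasurableSpace Y] {κ : Measure Y} {φ : Y → ℝ}

theorem setLIntegral_sq_lt_le (hφ : Measurable φ) (hφ0 : ∀ y, 0 ≤ φ y) {C : ℝ≥0∞}
    (hC : ∀ t : ℝ, 0 < t → ENNReal.ofReal t * κ {y | t ≤ φ y} ≤ C) (s : ℝ) :
    ∫⁻ y in {y | φ y < s}, ENNReal.ofReal (φ y ^ 2) ∂κ ≤ 2 * (C * ENNReal.ofReal s) := by
  have hcake := lintegral_rpow_eq_lintegral_meas_le_mul (κ.restrict {y | φ y < s})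
    (.of_forall hφ0) hφ.aemeasurable (p := 2) two_pos
  have hlevel (t : ℝ) (ht : t ∈ Set.Ioi (0 : ℝ)) :
      κ.restrict {y | φ y < s} {y | t ≤ φ y} * ENNReal.ofReal (t ^ ((2 : ℝ) - 1)) ≤
        (Set.Iio s).indicator (fun _ => C) t := by
    rw [Measure.restrict_apply (measurableSet_le measurable_const hφ), mul_comm,
      show (2 : ℝ) - 1 = 1 by norm_num, Real.rpow_one]
    by_cases hts : t < s
    · rw [Set.indicator_of_mem (Set.mem_Iio.2 hts)]
      exact (mul_le_mul_right (measure_mono Set.inter_subset_left) _).trans (hC t ht)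
    · have hempty : {y | t ≤ φ y} ∩ {y | φ y < s} = ∅ :=
        Set.eq_empty_of_forall_notMem fun y hy => hts (hy.1.trans_lt hy.2)
      simp [hempty]
  simp only [Real.rpow_two, ENNReal.ofReal_ofNat] at hcake
  calc ∫⁻ y in {y | φ y < s}, ENNReal.ofReal (φ y ^ 2) ∂κ
      ≤ 2 * ∫⁻ t in Set.Ioi (0 : ℝ), (Set.Iio s).indicator (fun _ => C) t := by
        grw [hcake, setLIntegral_mono' measurableSet_Ioi hlevel]
    _ = 2 * (C * ENNReal.ofReal s) := by
        rw [lintegral_indicator_const measurableSet_Iio, Measure.restrict_apply measurableSet_Iio,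
          Set.Iio_inter_Ioi, Real.volume_Ioo, sub_zero]

end Tail

section Coefficients

variable {ι 𝕜 X : Type*} [RCLike 𝕜] [MeasurableSpace X] {μ : Measure X} {u : ι → Lp 𝕜 2 μ}
  {f g : X → 𝕜} {j : ι}

/-- The coefficients `∫ f(x) conj(u_j(x)) dμ(x)` of a function with respect to a family in
`L²(μ)`; the function itself need not be in `L²(μ)`. -/
noncomputable def coeff (u : ι → Lp 𝕜 2 μ) (f : X → 𝕜) (j : ι) : 𝕜 :=
  ∫ x, f x * conj (u j x) ∂μ

theorem integrable_mul_conj {p : ℝ≥0∞} (hp1 : 1 ≤ p) (hp2 : p ≤ 2) (hf : MemLp f p μ)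
    (hg2 : MemLp g 2 μ) (hg : MemLp g ∞ μ) : Integrable (fun x => f x * conj (g x)) μ := by
  have hconj := ENNReal.HolderConjugate.conjExponent hp1
  have hq : 2 ≤ p.conjExponent := by
    have hp : p - 1 ≤ 1 := tsub_le_iff_right.2 (hp2.trans_eq one_add_one_eq_two.symm)
    grw [ENNReal.conjExponent, ← one_add_one_eq_two, ← ENNReal.one_le_inv.2 hp]
  exact hf.integrable_mul (memLp_of_le_of_memLp_top two_ne_zero hq hg2 hg).star

theorem coeff_congr_ae (h : f =ᵐ[μ] g) : coeff u f = coeff u g :=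
  funext fun _ => integral_congr_ae (h.mono fun x hx => by simp only [hx])

theorem coeff_add (hu : MemLp (u j) ∞ μ) (hf : MemLp f 1 μ) (hg : MemLp g 2 μ) :
    coeff u (f + g) j = coeff u f j + coeff u g j := by
  simp only [coeff, Pi.add_apply, add_mul]
  exact integral_add (integrable_mul_conj le_rfl one_le_two hf (Lp.memLp _) hu)
    (integrable_mul_conj one_le_two le_rfl hg (Lp.memLp _) hu)

theorem enorm_coeff_le (hf : AEStronglyMeasurable f μ) :
    ‖coeff u f j‖ₑ ≤ eLpNorm (u j) ∞ μ * eLpNorm f 1 μ :=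
  calc ‖coeff u f j‖ₑ
      ≤ ∫⁻ x, ‖f x * conj (u j x)‖ₑ ∂μ := enorm_integral_le_lintegral_enorm _
    _ ≤ ∫⁻ x, eLpNorm (u j) ∞ μ * ‖f x‖ₑ ∂μ := by
        rw [eLpNorm_exponent_top]
        refine lintegral_mono_ae ?_
        filter_upwards [ae_le_eLpNormEssSup (f := u j) (μ := μ)] with x hx
        rw [enorm_mul, RCLike.enorm_conj, mul_comm]
        gcongr
    _ = eLpNorm (u j) ∞ μ * eLpNorm f 1 μ := by
        rw [lintegral_const_mul'' _ hf.enorm, eLpNorm_one_eq_lintegral_enorm]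

theorem tsum_enorm_coeff_sq_le (hu : Orthonormal 𝕜 u) (hf : MemLp f 2 μ) :
    ∑' j, ‖coeff u f j‖ₑ ^ (2 : ℝ) ≤ eLpNorm f 2 μ ^ (2 : ℝ) := by
  have hinner (j : ι) : coeff u f j = inner 𝕜 (u j) hf.toLp := by
    rw [L2.inner_def]
    refine integral_congr_ae ?_
    filter_upwards [hf.coeFn_toLp] with x hx
    rw [hx, RCLike.inner_apply]
  rw [← Lp.enorm_toLp hf]
  refine ENNReal.summable.tsum_le_of_sum_le fun s => ?_
  simp_rw [hinner, ENNReal.rpow_two, ← ofReal_norm, ← ENNReal.ofReal_pow (norm_nonneg _)]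
  rw [← ENNReal.ofReal_sum_of_nonneg fun _ _ => by positivity]
  exact ENNReal.ofReal_le_ofReal (hu.sum_inner_products_le hf.toLp)

end Coefficients

section Paley

variable {ι 𝕜 X : Type*} [RCLike 𝕜] [MeasurableSpace X] {μ : Measure X} {u : ι → Lp 𝕜 2 μ}
  {φ : ι → ℝ}

/-- The constant `M_φ = sup_{t > 0} t ∑_{φ(j) ≥ t} ‖u_j‖_∞²` in Paley's inequality. -/
noncomputable def paleyBound (u : ι → Lp 𝕜 2 μ) (φ : ι → ℝ) : ℝ≥0∞ :=
  ⨆ (t : ℝ) (_ : 0 < t), ENNReal.ofReal t * ∑' j : {j // t ≤ φ j}, eLpNorm (u j) ∞ μ ^ 2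

/-- The weight `w_j = ‖u_j‖_∞ φ(j)` of Paley's inequality, with junk value `0` where `u_j` is
unbounded or `φ(j)` is negative. -/
noncomputable def paleyWeight (u : ι → Lp 𝕜 2 μ) (φ : ι → ℝ) (j : ι) : ℝ≥0 :=
  (eLpNorm (u j) ∞ μ).toNNReal * (φ j).toNNReal

/-- The sublinear operator `f ↦ |∫ f conj(u_j)| / w_j`, to which Marcinkiewicz interpolation is
applied. -/
noncomputable def paleyOperator (u : ι → Lp 𝕜 2 μ) (φ : ι → ℝ) (f : X → 𝕜) (j : ι) : ℝ≥0 :=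
  ‖coeff u f j‖₊ / paleyWeight u φ j

/-- The measure with mass `w_j²` at each index `j`. -/
noncomputable def paleyMeasure [MeasurableSpace ι] (u : ι → Lp 𝕜 2 μ) (φ : ι → ℝ) : Measure ι :=
  .withDensity .count fun j => (paleyWeight u φ j : ℝ≥0∞) ^ 2

theorem ofReal_mul_tsum_le_paleyBound {t : ℝ} (ht : 0 < t) :
    ENNReal.ofReal t * ∑' j : {j // t ≤ φ j}, eLpNorm (u j) ∞ μ ^ 2 ≤ paleyBound u φ :=
  le_iSup₂ (f := fun (t : ℝ) (_ : 0 < t) =>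
    ENNReal.ofReal t * ∑' j : {j // t ≤ φ j}, eLpNorm (u j) ∞ μ ^ 2) t ht

theorem ofReal_mul_eLpNorm_top_sq_le_paleyBound {j : ι} (hφ : 0 < φ j) :
    ENNReal.ofReal (φ j) * eLpNorm (u j) ∞ μ ^ 2 ≤ paleyBound u φ := by
  grw [← ofReal_mul_tsum_le_paleyBound hφ]
  gcongr
  exact ENNReal.le_tsum (f := fun i : {i // φ j ≤ φ i} => eLpNorm (u i) ∞ μ ^ 2) ⟨j, le_rfl⟩

theorem memLp_top_of_paleyBound_ne_top (hM : paleyBound u φ ≠ ∞) {j : ι} (hφ : 0 < φ j) :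
    MemLp (u j) ∞ μ := by
  refine ⟨Lp.aestronglyMeasurable _, Ne.lt_top fun h => hM ?_⟩
  have hle := ofReal_mul_eLpNorm_top_sq_le_paleyBound (u := u) hφ
  rwa [h, ENNReal.top_pow two_ne_zero, ENNReal.mul_top (by simpa using hφ), top_le_iff] at hle

theorem eLpNorm_top_ne_zero_of_orthonormal (hu : Orthonormal 𝕜 u) (j : ι) :
    eLpNorm (u j) ∞ μ ≠ 0 := by
  rw [Ne, eLpNorm_eq_zero_iff (Lp.aestronglyMeasurable _) ENNReal.top_ne_zero,
    ← Lp.eq_zero_iff_ae_eq_zero]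
  exact hu.ne_zero j

theorem paleyBound_ne_zero (hu : Orthonormal 𝕜 u) {j : ι} (hφ : 0 < φ j) : paleyBound u φ ≠ 0 :=
  ((ENNReal.mul_pos (by simpa using hφ)
    (pow_ne_zero 2 (eLpNorm_top_ne_zero_of_orthonormal hu j))).trans_le
      (ofReal_mul_eLpNorm_top_sq_le_paleyBound hφ)).ne'

theorem coe_paleyWeight (hM : paleyBound u φ ≠ ∞) {j : ι} (hφ : 0 < φ j) :
    (paleyWeight u φ j : ℝ≥0∞) = eLpNorm (u j) ∞ μ * ENNReal.ofReal (φ j) := by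
  rw [paleyWeight, ENNReal.coe_mul,
    ENNReal.coe_toNNReal (memLp_top_of_paleyBound_ne_top hM hφ).2.ne]
  rfl

theorem paleyWeight_ne_zero (hu : Orthonormal 𝕜 u) (hM : paleyBound u φ ≠ ∞) {j : ι}
    (hφ : 0 < φ j) : paleyWeight u φ j ≠ 0 := by
  rw [← ENNReal.coe_ne_zero, coe_paleyWeight hM hφ]
  exact mul_ne_zero (eLpNorm_top_ne_zero_of_orthonormal hu j) (by simpa using hφ)

theorem paleyOperator_add_le {f g : X → 𝕜} {j : ι} (hu : MemLp (u j) ∞ μ) (hf : MemLp f 1 μ)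
    (hg : MemLp g 2 μ) :
    paleyOperator u φ (f + g) j ≤ paleyOperator u φ f j + paleyOperator u φ g j := by
  rw [paleyOperator, paleyOperator, paleyOperator, coeff_add hu hf hg, ← add_div]
  gcongr
  exact nnnorm_add_le _ _

section Measure

variable [MeasurableSpace ι] [DiscreteMeasurableSpace ι]

theorem lintegral_div_rpow_withDensity_count {c w : ι → ℝ≥0} (hw : ∀ j, w j ≠ 0) {p : ℝ}
    (hp : 0 ≤ p) :
    ∫⁻ j, ((c j / w j : ℝ≥0) : ℝ≥0∞) ^ p ∂Measure.count.withDensity (fun j => (w j : ℝ≥0∞) ^ 2) =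
      ∑' j, (c j : ℝ≥0∞) ^ p * (w j : ℝ≥0∞) ^ (2 - p) := by
  rw [lintegral_withDensity_eq_lintegral_mul _ (by fun_prop) (by fun_prop), lintegral_count]
  refine tsum_congr fun j => ?_
  have hj : (w j : ℝ≥0∞) ≠ 0 := ENNReal.coe_ne_zero.2 (hw j)
  rw [Pi.mul_apply, ENNReal.coe_div (hw j), ENNReal.div_rpow_of_nonneg _ _ hp,
    ENNReal.rpow_sub _ _ hj ENNReal.coe_ne_top, ENNReal.rpow_two, div_eq_mul_inv,
    div_eq_mul_inv, mul_left_comm]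

theorem lintegral_paleyOperator_rpow (hw : ∀ j, paleyWeight u φ j ≠ 0) {p : ℝ} (hp : 0 ≤ p)
    (f : X → 𝕜) :
    ∫⁻ j, (paleyOperator u φ f j : ℝ≥0∞) ^ p ∂paleyMeasure u φ =
      ∑' j, ‖coeff u f j‖ₑ ^ p * (paleyWeight u φ j : ℝ≥0∞) ^ (2 - p) :=
  lintegral_div_rpow_withDensity_count hw hp

theorem paleyMeasure_lt_le (hφ : ∀ j, 0 ≤ φ j) (s : ℝ) :
    paleyMeasure u φ {j | φ j < s} ≤ 2 * (paleyBound u φ * ENNReal.ofReal s) := by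
  set κ : Measure ι := Measure.count.withDensity fun j => eLpNorm (u j) ∞ μ ^ 2
  have hκ (t : ℝ) (ht : 0 < t) : ENNReal.ofReal t * κ {j | t ≤ φ j} ≤ paleyBound u φ := by
    rw [withDensity_apply _ .of_discrete, ← lintegral_indicator .of_discrete, lintegral_count,
      ← tsum_subtype]
    exact ofReal_mul_tsum_le_paleyBound ht
  refine le_trans ?_ (setLIntegral_sq_lt_le Measurable.of_discrete hφ hκ s)
  rw [setLIntegral_withDensity_eq_setLIntegral_mul _ .of_discrete (by fun_prop) .of_discrete,
    paleyMeasure, withDensity_apply _ .of_discrete]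
  gcongr with j
  rw [paleyWeight, ENNReal.coe_mul, mul_pow, Pi.mul_apply, ENNReal.ofReal_pow (hφ j)]
  gcongr
  · exact ENNReal.coe_toNNReal_le_self
  · rfl

theorem hasWeakType_one_paleyOperator (hu : Orthonormal 𝕜 u) (hφ : ∀ j, 0 < φ j)
    (hM : paleyBound u φ ≠ ∞) :
    HasWeakType (paleyOperator u φ) 1 (2 * (paleyBound u φ).toNNReal) μ (paleyMeasure u φ) := by
  intro g hg t
  simp only [NNReal.coe_one, ENNReal.rpow_one, ENNReal.coe_one] at hg ⊢
  rcases eq_or_ne t 0 with rfl | ht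
  · simp
  have hsub : {j | t < paleyOperator u φ g j} ⊆ {j | φ j < (eLpNorm g 1 μ).toReal / t} := by
    intro j (hj : t < paleyOperator u φ g j)
    rw [paleyOperator, lt_div_iff₀ (paleyWeight_ne_zero hu hM (hφ j)).bot_lt,
      ← ENNReal.coe_lt_coe, ENNReal.coe_mul, coe_paleyWeight hM (hφ j), mul_left_comm] at hj
    have hlt : t * ENNReal.ofReal (φ j) < eLpNorm g 1 μ :=
      lt_of_mul_lt_mul_left' (hj.trans_le (enorm_coeff_le hg.1))
    rw [Set.mem_ofPred_eq, lt_div_iff₀' (NNReal.coe_pos.2 ht.bot_lt),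
      ← ENNReal.ofReal_lt_iff_lt_toReal (mul_nonneg t.coe_nonneg (hφ j).le) hg.2.ne,
      ENNReal.ofReal_mul t.coe_nonneg, ENNReal.ofReal_coe_nnreal]
    exact hlt
  calc (t : ℝ≥0∞) * paleyMeasure u φ {j | t < paleyOperator u φ g j}
      ≤ t * (2 * (paleyBound u φ * ENNReal.ofReal ((eLpNorm g 1 μ).toReal / t))) := by
        grw [measure_mono hsub, paleyMeasure_lt_le fun j => (hφ j).le]
    _ = 2 * paleyBound u φ * (t * (eLpNorm g 1 μ / t)) := by
        rw [ENNReal.ofReal_div_of_pos (NNReal.coe_pos.2 ht.bot_lt), ENNReal.ofReal_toReal hg.2.ne,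
          ENNReal.ofReal_coe_nnreal]
        ring
    _ = _ := by
        rw [ENNReal.mul_div_cancel (ENNReal.coe_ne_zero.2 ht) ENNReal.coe_ne_top, ENNReal.coe_mul,
          ENNReal.coe_toNNReal hM, ENNReal.coe_ofNat]

theorem hasWeakType_two_paleyOperator (hu : Orthonormal 𝕜 u) (hw : ∀ j, paleyWeight u φ j ≠ 0) :
    HasWeakType (paleyOperator u φ) 2 1 μ (paleyMeasure u φ) := by
  intro g hg t
  calc (t : ℝ≥0∞) ^ (2 : ℝ) * paleyMeasure u φ {j | t < paleyOperator u φ g j}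
      ≤ (t : ℝ≥0∞) ^ (2 : ℝ) * paleyMeasure u φ
          {j | (t : ℝ≥0∞) ^ (2 : ℝ) ≤ (paleyOperator u φ g j : ℝ≥0∞) ^ (2 : ℝ)} := by
        gcongr with j
        intro hj
        gcongr
    _ ≤ ∫⁻ j, (paleyOperator u φ g j : ℝ≥0∞) ^ (2 : ℝ) ∂paleyMeasure u φ :=
        mul_meas_ge_le_lintegral .of_discrete _
    _ = ∑' j, ‖coeff u g j‖ₑ ^ (2 : ℝ) := by
        simp only [lintegral_paleyOperator_rpow hw zero_le_two, sub_self, ENNReal.rpow_zero,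
          mul_one]
    _ ≤ _ := by simpa using tsum_enorm_coeff_sq_le hu hg

end Measure

end Paley

section Inequality

variable {ι 𝕜 X : Type*} [RCLike 𝕜] [MeasurableSpace X] {μ : Measure X} [SFinite μ]
  {u : ι → Lp 𝕜 2 μ} {φ : ι → ℝ} {f : X → 𝕜} {p : ℝ}

theorem lintegral_paleyOperator_rpow_le [MeasurableSpace ι] [DiscreteMeasurableSpace ι] [Nonempty ι]
    (hp1 : 1 < p) (hp2 : p < 2) (hu : Orthonormal 𝕜 u) (hφ : ∀ j, 0 < φ j)
    (hM : paleyBound u φ ≠ ∞) (hf : MemLp f (ENNReal.ofReal p) μ) :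
    ∫⁻ j, (paleyOperator u φ f j : ℝ≥0∞) ^ p ∂paleyMeasure u φ ≤
      (marcinkiewiczConst p * 2 ^ (2 - p) : ℝ≥0) * paleyBound u φ ^ (2 - p) *
        eLpNorm f (ENNReal.ofReal p) μ ^ p := by
  obtain ⟨g, hg, hfg⟩ := hf.1
  have hT : paleyOperator u φ f = paleyOperator u φ g := by
    funext j
    rw [paleyOperator, paleyOperator, coeff_congr_ae hfg]
  have hM0 : (paleyBound u φ).toNNReal ≠ 0 :=
    ENNReal.toNNReal_ne_zero.2 ⟨paleyBound_ne_zero hu (hφ (Classical.arbitrary ι)), hM⟩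
  have hinterp := lintegral_rpow_le_of_hasWeakType hp1 hp2
    (fun g h hg hh j => paleyOperator_add_le (memLp_top_of_paleyBound_ne_top hM (hφ j)) hg hh)
    (mul_ne_zero two_ne_zero hM0) one_ne_zero (hasWeakType_one_paleyOperator hu hφ hM)
    (hasWeakType_two_paleyOperator hu fun j => paleyWeight_ne_zero hu hM (hφ j))
    hg ((memLp_congr_ae hfg).1 hf) Measurable.of_discrete.aemeasurable
  have hp0 : 0 < p := zero_lt_one.trans hp1
  have hnorm : eLpNorm f (ENNReal.ofReal p) μ ^ p = ∫⁻ x, ‖g x‖ₑ ^ p ∂μ := by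
    have h := eLpNorm_nnreal_pow_eq_lintegral (f := g) (μ := μ) (Real.toNNReal_pos.2 hp0).ne'
    rw [Real.coe_toNNReal p hp0.le] at h
    rw [eLpNorm_congr_ae hfg]
    exact h
  rw [hT, hnorm]
  refine hinterp.trans_eq ?_
  rw [NNReal.one_rpow, mul_one, NNReal.mul_rpow, ← mul_assoc, ENNReal.coe_mul,
    ENNReal.coe_rpow_of_nonneg (paleyBound u φ).toNNReal (by linarith), ENNReal.coe_toNNReal hM]

theorem tsum_enorm_coeff_rpow_le_of_lt_two (hp1 : 1 < p) (hp2 : p < 2) (hu : Orthonormal 𝕜 u)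
    (hφ : ∀ j, 0 < φ j) (hM : paleyBound u φ ≠ ∞) (hf : MemLp f (ENNReal.ofReal p) μ) :
    ∑' j, ‖coeff u f j‖ₑ ^ p * eLpNorm (u j) ∞ μ ^ (2 - p) * ENNReal.ofReal (φ j) ^ (2 - p) ≤
      (marcinkiewiczConst p * 2 ^ (2 - p) : ℝ≥0) * paleyBound u φ ^ (2 - p) *
        eLpNorm f (ENNReal.ofReal p) μ ^ p := by
  cases isEmpty_or_nonempty ι
  · simp
  let : MeasurableSpace ι := ⊤
  convert lintegral_paleyOperator_rpow_le hp1 hp2 hu hφ hM hf using 1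
  rw [lintegral_paleyOperator_rpow (fun j => paleyWeight_ne_zero hu hM (hφ j)) (by linarith)]
  refine tsum_congr fun j => ?_
  rw [coe_paleyWeight hM (hφ j), ENNReal.mul_rpow_of_nonneg _ _ (by linarith), mul_assoc]

/-- The constant in Paley's inequality for the `p`-th powers of the norms. -/
noncomputable def paleyInequalityConst (p : ℝ) : ℝ≥0 :=
  if p < 2 then marcinkiewiczConst p * 2 ^ (2 - p) else 1

theorem tsum_enorm_coeff_rpow_le (hp1 : 1 < p) (hp2 : p ≤ 2) (hu : Orthonormal 𝕜 u)
    (hφ : ∀ j, 0 < φ j) (hM : paleyBound u φ ≠ ∞) (hf : MemLp f (ENNReal.ofReal p) μ) :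
    ∑' j, ‖coeff u f j‖ₑ ^ p * eLpNorm (u j) ∞ μ ^ (2 - p) * ENNReal.ofReal (φ j) ^ (2 - p) ≤
      paleyInequalityConst p * paleyBound u φ ^ (2 - p) * eLpNorm f (ENNReal.ofReal p) μ ^ p := by
  rcases hp2.lt_or_eq with h | rfl
  · rw [paleyInequalityConst, if_pos h]
    exact tsum_enorm_coeff_rpow_le_of_lt_two hp1 h hu hφ hM hf
  · rw [ENNReal.ofReal_ofNat] at hf ⊢
    simpa only [paleyInequalityConst, lt_irrefl, if_false, sub_self, ENNReal.rpow_zero, mul_one,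
      one_mul, ENNReal.coe_one] using tsum_enorm_coeff_sq_le hu hf

end Inequality

end Paley

theorem theorem4p1_general {p : ℝ} (hp1 : 1 < p) (hp2 : p ≤ 2) :
    ∃ C : ℝ≥0, ∀ {ι 𝕜 X : Type*} [RCLike 𝕜] [MeasurableSpace X] (μ : Measure X) [SFinite μ]
        (u : ι → Lp 𝕜 2 μ), Orthonormal 𝕜 u →
      ∀ φ : ι → ℝ, (∀ j, 0 < φ j) → Paley.paleyBound u φ < ∞ →
      ∀ f : X → 𝕜, MemLp f (ENNReal.ofReal p) μ →
        (∀ j, Integrable (fun x => f x * conj (u j x)) μ) ∧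
        (∑' j, ‖Paley.coeff u f j‖ₑ ^ p * eLpNorm (u j) ∞ μ ^ (2 - p) *
            ENNReal.ofReal (φ j) ^ (2 - p)) ^ (1 / p) ≤
          C * Paley.paleyBound u φ ^ ((2 - p) / p) * eLpNorm f (ENNReal.ofReal p) μ := by
  have hp0 : 0 < p := zero_lt_one.trans hp1
  have hinv : 0 ≤ 1 / p := by positivity
  refine ⟨Paley.paleyInequalityConst p ^ (1 / p), fun μ _ u hu φ hφ hM f hf => ⟨fun j => ?_, ?_⟩⟩
  · exact Paley.integrable_mul_conj (by simpa using hp1.le) (by simpa using hp2) hf (Lp.memLp _)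
      (Paley.memLp_top_of_paleyBound_ne_top hM.ne (hφ j))
  · grw [Paley.tsum_enorm_coeff_rpow_le hp1 hp2 hu hφ hM.ne hf]
    rw [ENNReal.mul_rpow_of_nonneg _ _ hinv, ENNReal.mul_rpow_of_nonneg _ _ hinv,
      ← ENNReal.rpow_mul, ← ENNReal.rpow_mul, mul_one_div, mul_one_div_cancel hp0.ne',
      ENNReal.rpow_one, ENNReal.coe_rpow_of_nonneg _ hinv]

theorem theorem4p1 (p : ℝ) (hp1 : 1 < p) (hp2 : p ≤ 2) :
    ∃ C : ℝ≥0, ∀ (n k l : ℕ), 1 ≤ n → 1 ≤ k → 1 ≤ l →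
      ∀ (lam : ℕ → ℝ)
        (u : HilbertBasis ℕ ℂ (Lp ℂ 2 (volume : Measure (EuclideanSpace ℝ (Fin n))))),
        Anharmonic.IsEigenbasis n k l lam u →
      ∀ φ : ℕ → ℝ, (∀ j, 0 < φ j) → Anharmonic.paleyConst u φ < ∞ →
      ∀ f : EuclideanSpace ℝ (Fin n) → ℂ, MemLp f (ENNReal.ofReal p) volume →
        (∀ j, Integrable (fun x => f x * conj (u j x)) volume) ∧
        (∑' j, ‖Anharmonic.fourier u f j‖ₑ ^ p * Anharmonic.supNorm u j ^ (2 - p) *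
            ENNReal.ofReal (φ j) ^ (2 - p)) ^ (1 / p) ≤
          (C : ℝ≥0∞) * Anharmonic.paleyConst u φ ^ ((2 - p) / p) *
            eLpNorm f (ENNReal.ofReal p) volume :=
  (theorem4p1_general hp1 hp2).imp fun _ hC _ _ _ _ _ _ _ u _ φ hφ hM f hf =>
    hC volume u u.orthonormal φ hφ hM f hf
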